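/- Let $Z$ be an observation with law $P$, let $X$ be a (measurable) part of $Z$, let $g_0$ be the true nuisance in a nuisance space $G$, and let $\hat Y(g)=\hat Y(g)(Z)$, $g\in G$, be (jointly measurable) labels such that $\hat Y(g_0)$ is integrable. Put $\tau_0(X):=\mathbb{E}[\hat Y(g_0)\mid X]$ and assume $\mathbb{E}[\tau_0(X)^2]<\infty$. Write $\|h-h'\|^2=\mathbb{E}[(h(X)-h'(X))^2]$ for the mean squared distance at a fresh observation. Let $f_1,\dots,f_M$ be fixed candidate functions, let $\Theta=\{\theta\in\mathbb{R}_{\ge 0}^M:\sum_j\theta_j=1\}$ and $f_\theta=\sum_j\theta_jf_j$, and let $\pi_1,\dots,\pi_M>0$ be prior weights with $\sum_j\pi_j=1$. Let $Z_1,\dots,Z_n$ ($n\ge 1$) be i.i.d. with law $P$, with covariates $X_1,\dots,X_n$, and let $\hat g$ be a random element of $G$ independent of $(Z_1,\dots,Z_n)$ (an estimate of $g_0$ trained on a separate sample). Let $$\mathrm{Bias}(X;g)=\mathbb{E}[\hat Y(g)-\hat Y(g_0)\mid X],\qquad \mathrm{Error}(g)=2\sqrt{\mathbb{E}[\mathrm{Bias}(X;g)^2]},$$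 where the expectations are over a fresh $Z$ with $g$ held fixed. Assume that, almost surely, $|\hat Y(\hat g)|\le U$ and $|f_j(X)|\le U$ for all $j$. For $\ell_{\theta,g}(Z)=(\hat Y(g)(Z)-f_\theta(X))^2$ and $\nu=1/2$, with $e_j$ the $j$-th unit vector, let $\hat\theta$ be any Q-aggregation weights, that is, any minimizer over $\theta\in\Theta$ of $$\frac1n\sum_{i=1}^n\Big[(1-\nu)\,\ell_{\theta,\hat g}(Z_i)+\nu\sum_{j=1}^M\theta_j\,\ell_{e_j,\hat g}(Z_i)\Big]+\frac{\beta}{n}\sum_{j=1}^M\theta_j\log(1/\pi_j),$$ where $\beta\ge\max\{112\,U^2,\,56\,U^3\}$. Then there is a universal constant $C$ such that for every $\delta\in(0,1)$, with probability at least $1-\delta$, $$\|f_{\hat\theta}-\tau_0\|^2\le\min_{1\le j\le M}\Big[\|f_j-\tau_0\|^2+\frac{\beta}{n}\log(1/\pi_j)\Big]+C\Big(\frac{\max\{U^2,U^3\}\log(1/\delta)}{n}+\mathrm{Error}(\hat g)^2\Big).$$ -/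

import Mathlib

open MeasureTheory ProbabilityTheory

noncomputable section

namespace QAgg

variable {𝒵 𝒳 𝒢 : Type*} {M n : ℕ}

/-- The ensemble `f_θ = ∑ j, θ_j f_j`. -/
def ensemble (f : Fin M → 𝒳 → ℝ) (θ : Fin M → ℝ) (x : 𝒳) : ℝ :=
  ∑ j, θ j * f j x

/-- The square loss `ℓ(z; h(X), g) = (Ŷ(g)(z) - h(X(z)))²` of a predictor `h` at a nuisance `g`.
Here `X : 𝒵 → 𝒳` reads the covariates off a full observation, and `Y g z` is the label `Ŷ(g)`
of the observation `z`. -/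
def sqLoss (X : 𝒵 → 𝒳) (Y : 𝒢 → 𝒵 → ℝ) (h : 𝒳 → ℝ) (g : 𝒢) (z : 𝒵) : ℝ :=
  (Y g z - h (X z)) ^ 2

/-- The modified loss `(1 - ν) ℓ_{θ,g} + ν ∑ j, θ_j ℓ_{e_j,g}`. -/
def modifiedLoss (X : 𝒵 → 𝒳) (Y : 𝒢 → 𝒵 → ℝ) (f : Fin M → 𝒳 → ℝ) (ν : ℝ)
    (θ : Fin M → ℝ) (g : 𝒢) (z : 𝒵) : ℝ :=
  (1 - ν) * sqLoss X Y (ensemble f θ) g z + ν * ∑ j, θ j * sqLoss X Y (f j) g z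

/-- The Q-aggregation objective on the sample `z_1, …, z_n`: the empirical mean of the modified
loss plus `(β / n) ∑ j, θ_j log (1 / π_j)`. -/
def qObjective (X : 𝒵 → 𝒳) (Y : 𝒢 → 𝒵 → ℝ) (f : Fin M → 𝒳 → ℝ) (w : Fin M → ℝ) (ν β : ℝ)
    (g : 𝒢) (z : Fin n → 𝒵) (θ : Fin M → ℝ) : ℝ :=
  (1 / (n : ℝ)) * ∑ i, modifiedLoss X Y f ν θ g (z i)
    + β / (n : ℝ) * ∑ j, θ j * Real.log (1 / w j)

/-- `θ` is a Q-aggregation weight vector: a minimizer of the objective over the simplex. -/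
def IsQAggregation (X : 𝒵 → 𝒳) (Y : 𝒢 → 𝒵 → ℝ) (f : Fin M → 𝒳 → ℝ) (w : Fin M → ℝ) (ν β : ℝ)
    (g : 𝒢) (z : Fin n → 𝒵) (θ : Fin M → ℝ) : Prop :=
  θ ∈ stdSimplex ℝ (Fin M) ∧
    IsMinOn (qObjective X Y f w ν β g z) (stdSimplex ℝ (Fin M)) θ

/-- `‖h - h'‖² = E[(h(X) - h'(X))²]`. -/
def sqDist [MeasurableSpace 𝒵] (P : Measure 𝒵) (X : 𝒵 → 𝒳) (h h' : 𝒳 → ℝ) : ℝ :=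
  ∫ z, (h (X z) - h' (X z)) ^ 2 ∂P

/-- `Bias(X; g) = E[Ŷ(g) - Ŷ(g₀) | X]`, as a random variable on the observation space. -/
def bias [MeasurableSpace 𝒵] [m𝒳 : MeasurableSpace 𝒳] (P : Measure 𝒵) (X : 𝒵 → 𝒳)
    (Y : 𝒢 → 𝒵 → ℝ) (g₀ g : 𝒢) : 𝒵 → ℝ :=
  P[fun z => Y g z - Y g₀ z | MeasurableSpace.comap X m𝒳]

/-- `Error(g) = 2 √(E[Bias(X; g)²])`. -/
def nuisanceError [MeasurableSpace 𝒵] [MeasurableSpace 𝒳] (P : Measure 𝒵) (X : 𝒵 → 𝒳)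
    (Y : 𝒢 → 𝒵 → ℝ) (g₀ g : 𝒢) : ℝ :=
  2 * Real.sqrt (∫ z, (bias P X Y g₀ g z) ^ 2 ∂P)

end QAgg

end

/-! With `ν = 1/2` the modified loss is the average over pairs `(j, k)` drawn from `θ ⊗ θ` of the
loss of the midpoint `(f_j + f_k)/2`. So it is enough to control `M²` fixed functions with prior
`π_j π_k`, and nothing uniform over the simplex is needed.

Fix the oracle model `p`, and let `V = ∑ θ_j ‖f_j - f_p‖²`. Three facts combine. Optimality of `θ`,
tested infinitesimally towards `e_p` (`IsQAggregation.sum_pairExcess_le`), bounds the empirical pair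
excess, with the extra curvature `(f_θ - f_p)²/2` on the left. In the population
(`sqDist_ensemble_le`) that curvature leaves a surplus `-V/2`, and the wrong nuisance costs only `2
E[(f_θ - f_p) Bias]`, which is absorbed by a fraction of `V` plus a multiple of `E[Bias²]`. The
exponential-moment bound (`measure_exists_sum_gt_le`) passes from empirical to population means at
the price of a second moment, which is at most a multiple of `V`, and of log-prior terms. The
surplus pays for the first, the penalty `β` for the second. -/

/-! ### Exponential moments and the weighted union bound. -/

/-- A second order bound on the exponential moment of a random variable bounded by one. -/
theorem lintegral_exp_sub_integral_le_one {α : Type*} [MeasurableSpace α] {P : Measure α}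
    [IsProbabilityMeasure P] {v : α → ℝ} (hv : Measurable v) (hb : ∀ᵐ z ∂P, |v z| ≤ 1) :
    ∫⁻ z, ENNReal.ofReal (Real.exp (v z - ∫ x, v x ∂P - ∫ x, v x ^ 2 ∂P)) ∂P ≤ 1 := by
  have iv : Integrable v P := Integrable.of_bound hv.aestronglyMeasurable 1 hb
  have iv2 : Integrable (fun z => v z ^ 2) P := by
    refine Integrable.of_bound (hv.pow_const 2).aestronglyMeasurable 1 ?_
    filter_upwards [hb] with z hz
    rw [Real.norm_eq_abs, abs_pow]
    exact pow_le_one₀ (abs_nonneg _) hz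
  set a := ∫ x, v x ∂P with ha
  set b := ∫ x, v x ^ 2 ∂P with hbdef
  have hpt : ∀ᵐ z ∂P, ENNReal.ofReal (Real.exp (v z - a - b)) ≤
      ENNReal.ofReal (Real.exp (-a - b) * (1 + v z + v z ^ 2)) := by
    filter_upwards [hb] with z hz
    apply ENNReal.ofReal_le_ofReal
    have h1 := (abs_le.1 (Real.abs_exp_sub_one_sub_id_le hz)).2
    rw [show v z - a - b = (-a - b) + v z by ring, Real.exp_add]
    exact mul_le_mul_of_nonneg_left (by linarith) (Real.exp_nonneg _)
  refine (lintegral_mono_ae hpt).trans ?_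
  have i1 : Integrable (fun z => 1 + v z + v z ^ 2) P := ((integrable_const 1).add iv).add iv2
  rw [← ofReal_integral_eq_lintegral_ofReal (i1.const_mul _)]
  · have e1 : ∫ z, (1 + v z + v z ^ 2) ∂P = 1 + a + b := by
      rw [integral_add (f := fun z => 1 + v z) ((integrable_const 1).add iv) iv2,
        integral_add (integrable_const 1) iv, ← ha, ← hbdef]
      simp
    rw [integral_const_mul, e1, ENNReal.ofReal_le_one]
    calc Real.exp (-a - b) * (1 + a + b) ≤ Real.exp (-a - b) * Real.exp (a + b) :=
          mul_le_mul_of_nonneg_left (by linarith [Real.add_one_le_exp (a + b)])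
            (Real.exp_nonneg _)
      _ = 1 := by rw [← Real.exp_add]; ring_nf; exact Real.exp_zero
  · filter_upwards with z
    exact mul_nonneg (Real.exp_nonneg _) (by nlinarith [sq_nonneg (v z + 1 / 2)])

/-- Weighted union bound over finitely many functions of an i.i.d. sample which may depend on an
independent random parameter. -/
theorem measure_exists_sum_gt_le {Ω 𝒵 𝒢 ι : Type*} [MeasurableSpace Ω] [MeasurableSpace 𝒵]
    [MeasurableSpace 𝒢] [Fintype ι] {μ : Measure Ω} [IsProbabilityMeasure μ] {P : Measure 𝒵}
    [IsProbabilityMeasure P] {n : ℕ} {Z : Fin n → Ω → 𝒵} (hZ : ∀ i, Measurable (Z i))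
    (hind : iIndepFun Z μ) (hlaw : ∀ i, Measure.map (Z i) μ = P)
    {ghat : Ω → 𝒢} (hg : Measurable ghat) (hgZ : IndepFun ghat (fun ω i => Z i ω) μ)
    {v : ι → 𝒢 → 𝒵 → ℝ} (hv : ∀ a, Measurable (Function.uncurry (v a)))
    (hb : ∀ᵐ ω ∂μ, ∀ a, ∀ᵐ z ∂P, |v a (ghat ω) z| ≤ 1)
    {q : ι → ℝ} (hq : ∀ a, 0 < q a) (hq1 : ∑ a, q a = 1) {δ : ℝ} (hδ : 0 < δ) :
    μ {ω | ∃ a, n * (∫ z, v a (ghat ω) z ∂P + ∫ z, v a (ghat ω) z ^ 2 ∂P)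
      + (Real.log (1 / δ) + Real.log (1 / q a)) < ∑ i, v a (ghat ω) (Z i ω)}
      ≤ ENNReal.ofReal δ := by
  let φ : ι → 𝒢 → 𝒵 → ℝ := fun a g z =>
    Real.exp (v a g z - ∫ x, v a g x ∂P - ∫ x, v a g x ^ 2 ∂P)
  have hφ : ∀ a, Measurable (Function.uncurry (φ a)) := by
    intro a
    have h1 : Measurable fun g => ∫ x, v a g x ∂P :=
      (StronglyMeasurable.integral_prod_right' (hv a).stronglyMeasurable).measurable
    have h2 : Measurable fun g => ∫ x, v a g x ^ 2 ∂P :=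
      (StronglyMeasurable.integral_prod_right'
        ((hv a).pow_const 2).stronglyMeasurable).measurable
    exact (((hv a).sub (h1.comp measurable_fst)).sub (h2.comp measurable_fst)).exp
  -- A prior mixture of exponential products: its mean is at most one, so a single use of Markov's
  -- inequality replaces the union bound.
  let S : 𝒢 × (Fin n → 𝒵) → ENNReal := fun p =>
    ∑ a, ENNReal.ofReal (q a) * ∏ i, ENNReal.ofReal (φ a p.1 (p.2 i))
  have hS : Measurable S := by
    refine Finset.measurable_sum _ fun a _ => Measurable.const_mul ?_ _
    refine Finset.measurable_prod _ fun i _ => ENNReal.measurable_ofReal.comp ?_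
    exact (hφ a).comp (measurable_fst.prodMk ((measurable_pi_apply i).comp measurable_snd))
  have hZm : Measurable fun ω i => Z i ω := measurable_pi_lambda _ hZ
  have hφg : ∀ a g, Measurable (φ a g) := fun a g => (hφ a).comp measurable_prodMk_left
  have hvg : ∀ a g, Measurable (v a g) := fun a g => (hv a).comp measurable_prodMk_left
  have : IsProbabilityMeasure (Measure.map (fun ω i => Z i ω) μ) :=
    Measure.isProbabilityMeasure_map hZm.aemeasurable
  have hint : ∫⁻ ω, S (ghat ω, fun i => Z i ω) ∂μ ≤ 1 := by
    -- Independence turns the joint law into a product, so the nuisance can be frozen before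
    -- integrating over the sample.
    rw [← lintegral_map (f := S) hS (hg.prodMk hZm),
      (indepFun_iff_map_prod_eq_prod_map_map hg.aemeasurable hZm.aemeasurable).1 hgZ,
      lintegral_prod _ hS.aemeasurable, lintegral_map hS.lintegral_prod_right' hg]
    have : ∀ᵐ ω ∂μ, ∫⁻ z, S (ghat ω, z) ∂(Measure.map (fun ω i => Z i ω) μ) ≤ 1 := by
      filter_upwards [hb] with ω hω
      rw [lintegral_map (f := fun z => S (ghat ω, z)) (hS.comp measurable_prodMk_left) hZm]
      have hprod : ∀ a, ∫⁻ ω', ∏ i, ENNReal.ofReal (φ a (ghat ω) (Z i ω')) ∂μ ≤ 1 := by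
        intro a
        have hm : Measurable fun z => ENNReal.ofReal (φ a (ghat ω) z) :=
          ENNReal.measurable_ofReal.comp (hφg a _)
        have hi := hind.comp (fun _ z => ENNReal.ofReal (φ a (ghat ω) z)) fun _ => hm
        rw [lintegral_prod_eq_prod_lintegral_of_indepFun Finset.univ
          (fun i ω' => ENNReal.ofReal (φ a (ghat ω) (Z i ω'))) hi fun i => hm.comp (hZ i)]
        refine Finset.prod_le_one' fun i _ => ?_
        rw [← lintegral_map hm (hZ i), hlaw i]
        exact lintegral_exp_sub_integral_le_one (hvg a _) (hω a)
      simp only [S]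
      rw [lintegral_finsetSum]
      · calc ∑ a, ∫⁻ ω', ENNReal.ofReal (q a) * ∏ i, ENNReal.ofReal (φ a (ghat ω) (Z i ω')) ∂μ
            ≤ ∑ a, ENNReal.ofReal (q a) := by
              refine Finset.sum_le_sum fun a _ => ?_
              rw [lintegral_const_mul' _ _ ENNReal.ofReal_ne_top]
              exact mul_le_of_le_one_right' (hprod a)
          _ = 1 := by
              rw [← ENNReal.ofReal_sum_of_nonneg fun a _ => (hq a).le, hq1, ENNReal.ofReal_one]
      · intro a _
        refine Measurable.const_mul (Finset.measurable_prod _ fun i _ => ?_) _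
        exact ENNReal.measurable_ofReal.comp ((hφg a _).comp (hZ i))
    refine (lintegral_mono_ae this).trans ?_
    simp
  have hmk := (mul_meas_ge_le_lintegral (hS.comp (hg.prodMk hZm))
    (ENNReal.ofReal δ⁻¹)).trans hint
  have hsub : {ω | ∃ a, n * (∫ z, v a (ghat ω) z ∂P + ∫ z, v a (ghat ω) z ^ 2 ∂P)
      + (Real.log (1 / δ) + Real.log (1 / q a)) < ∑ i, v a (ghat ω) (Z i ω)} ⊆
      {ω | ENNReal.ofReal δ⁻¹ ≤ (S ∘ fun ω => (ghat ω, fun i => Z i ω)) ω} := by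
    rintro ω ⟨a, ha⟩
    -- A deviation at `a` makes the `a`-th summand alone exceed `1 / δ`.
    refine le_trans ?_ (Finset.single_le_sum (f := fun a => ENNReal.ofReal (q a) *
      ∏ i, ENNReal.ofReal (φ a (ghat ω) (Z i ω))) (fun _ _ => zero_le) (Finset.mem_univ a))
    rw [← ENNReal.ofReal_prod_of_nonneg fun i _ => Real.exp_nonneg _,
      ← ENNReal.ofReal_mul (hq a).le]
    apply ENNReal.ofReal_le_ofReal
    rw [← Real.exp_sum, ← Real.log_le_log_iff (inv_pos.2 hδ)
      (mul_pos (hq a) (Real.exp_pos _)), Real.log_mul (hq a).ne' (Real.exp_ne_zero _),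
      Real.log_exp]
    simp only [one_div, Real.log_inv, Finset.sum_sub_distrib, Finset.sum_const,
      Finset.card_univ, Fintype.card_fin, nsmul_eq_mul] at ha ⊢
    linarith
  refine (measure_mono hsub).trans ?_
  rw [ENNReal.ofReal_inv_of_pos hδ] at *
  have := (ENNReal.inv_mul_le_iff (by simpa using hδ) ENNReal.ofReal_ne_top).1 hmk
  simpa using this

namespace QAgg

variable {𝒵 𝒳 𝒢 : Type*} {M n : ℕ}

/-! ### Algebra of the pairwise excess loss. -/

/-- The loss at `y` of the average of the predictions `b` and `c`, in excess of the loss of the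
reference prediction `a`, with a curvature term added. Its average over pairs `(j, k)` drawn from
`θ ⊗ θ` is the excess of the modified loss with `ν = 1 / 2`. -/
noncomputable def pairExcess (y a b c : ℝ) : ℝ :=
  (y - (b + c) / 2) ^ 2 - (y - a) ^ 2 + (b - a) * (c - a) / 2

/-- Factoring the difference of squares gives `2U`; the product term gives `U/2`, by averaging its
two bounds `2U|b - a|` and `2U|c - a|`. -/
theorem abs_pairExcess_le {U y a b c : ℝ} (hy : |y| ≤ U) (ha : |a| ≤ U) (hb : |b| ≤ U)
    (hc : |c| ≤ U) : |pairExcess y a b c| ≤ 5 / 2 * U * (|b - a| + |c - a|) := by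
  have e : pairExcess y a b c =
      -((b - a) + (c - a)) / 2 * (2 * y - (b + c) / 2 - a) + (b - a) * (c - a) / 2 := by
    unfold pairExcess; ring
  rw [abs_le] at hy ha hb hc
  have h1 : |2 * y - (b + c) / 2 - a| ≤ 4 * U := by rw [abs_le]; constructor <;> linarith
  have h2 : |b - a| ≤ 2 * U := by rw [abs_le]; constructor <;> linarith
  have h3 : |c - a| ≤ 2 * U := by rw [abs_le]; constructor <;> linarith
  have h4 : |(b - a) + (c - a)| ≤ |b - a| + |c - a| := abs_add_le _ _
  rw [e]
  refine (abs_add_le _ _).trans ?_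
  rw [abs_mul, abs_div, abs_neg, abs_div, abs_mul, abs_two]
  have h5 := mul_le_mul h4 h1 (abs_nonneg _) (by positivity)
  have h6 := mul_le_mul_of_nonneg_left h3 (abs_nonneg (b - a))
  have h7 := mul_le_mul_of_nonneg_left h2 (abs_nonneg (c - a))
  linarith

theorem abs_pairExcess_le_const {U y a b c : ℝ} (hy : |y| ≤ U) (ha : |a| ≤ U) (hb : |b| ≤ U)
    (hc : |c| ≤ U) : |pairExcess y a b c| ≤ 10 * U ^ 2 := by
  have h := abs_pairExcess_le hy ha hb hc
  have hU : 0 ≤ U := (abs_nonneg _).trans hy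
  have h2 : |b - a| ≤ 2 * U := (abs_sub _ _).trans (by linarith)
  have h3 : |c - a| ≤ 2 * U := (abs_sub _ _).trans (by linarith)
  nlinarith

/-- A Bernstein-type condition: second moments are controlled by the distances to the reference,
which the curvature can pay for. -/
theorem sq_pairExcess_le {U y a b c : ℝ} (hy : |y| ≤ U) (ha : |a| ≤ U) (hb : |b| ≤ U)
    (hc : |c| ≤ U) :
    pairExcess y a b c ^ 2 ≤ 25 / 2 * U ^ 2 * ((b - a) ^ 2 + (c - a) ^ 2) := by
  have h := pow_le_pow_left₀ (abs_nonneg _) (abs_pairExcess_le hy ha hb hc) 2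
  rw [sq_abs] at h
  refine h.trans ?_
  rw [← sq_abs (b - a), ← sq_abs (c - a), mul_pow]
  nlinarith [mul_nonneg (sq_nonneg U) (sq_nonneg (|b - a| - |c - a|))]

theorem sum_sum_mul_symm {θ : Fin M → ℝ} (hθ : ∑ j, θ j = 1) (W : Fin M → ℝ) :
    ∑ j, ∑ k, θ j * θ k * (W j + W k) = 2 * ∑ j, θ j * W j := by
  have h1 : ∀ j, ∑ k, θ j * θ k * (W j + W k) = θ j * W j + θ j * ∑ k, θ k * W k := by
    intro j
    calc _ = ∑ k, (θ k * (θ j * W j) + θ j * (θ k * W k)) :=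
          Finset.sum_congr rfl fun k _ => by ring
      _ = _ := by rw [Finset.sum_add_distrib, ← Finset.sum_mul, hθ, one_mul, Finset.mul_sum]
  simp_rw [h1]
  rw [Finset.sum_add_distrib, ← Finset.sum_mul, hθ]
  ring

theorem sum_sum_mul_const {θ : Fin M → ℝ} (hθ : ∑ j, θ j = 1) (c : ℝ) :
    ∑ j, ∑ k, θ j * θ k * c = c := by
  simp_rw [← Finset.sum_mul, ← Finset.mul_sum]
  rw [hθ]
  simp [hθ]

/-- The right side is the excess modified loss plus half of `(∑ j, θ j * u j - a) ^ 2`, the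
contribution of the product term in `pairExcess`. -/
theorem sum_pairExcess {θ : Fin M → ℝ} (hθ : ∑ j, θ j = 1) (y a : ℝ) (u : Fin M → ℝ) :
    ∑ j, ∑ k, θ j * θ k * pairExcess y a (u j) (u k) =
      (∑ j, θ j * u j - a) ^ 2 - 2 * (y - a) * (∑ j, θ j * u j - a)
        + 1 / 2 * ∑ j, θ j * (u j - a) ^ 2 := by
  have h1 : ∑ j, θ j * u j - a = ∑ j, θ j * (u j - a) := by
    simp_rw [mul_sub]
    rw [Finset.sum_sub_distrib, ← Finset.sum_mul, hθ, one_mul]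
  have h2 : ∀ j k, θ j * θ k * pairExcess y a (u j) (u k) =
      θ j * (u j - a) * (θ k * (u k - a)) + θ j * θ k *
        ((1 / 4 * (u j - a) ^ 2 - (y - a) * (u j - a)) +
          (1 / 4 * (u k - a) ^ 2 - (y - a) * (u k - a))) := by
    intro j k; unfold pairExcess; ring
  simp_rw [h2, Finset.sum_add_distrib]
  rw [sum_sum_mul_symm hθ (fun j => 1 / 4 * (u j - a) ^ 2 - (y - a) * (u j - a)),
    ← Finset.sum_mul_sum, h1]
  have h3 : ∑ j, θ j * (1 / 4 * (u j - a) ^ 2 - (y - a) * (u j - a)) =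
      1 / 4 * ∑ j, θ j * (u j - a) ^ 2 - (y - a) * ∑ j, θ j * (u j - a) := by
    rw [Finset.mul_sum, Finset.mul_sum, ← Finset.sum_sub_distrib]
    exact Finset.sum_congr rfl fun j _ => by ring
  rw [h3]
  ring

theorem sq_sum_sub_le {θ : Fin M → ℝ} (h0 : ∀ j, 0 ≤ θ j) (hθ : ∑ j, θ j = 1) (a : ℝ)
    (u : Fin M → ℝ) : (∑ j, θ j * u j - a) ^ 2 ≤ ∑ j, θ j * (u j - a) ^ 2 := by
  have h1 : ∑ j, θ j * u j - a = ∑ j, θ j * (u j - a) := by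
    simp_rw [mul_sub]
    rw [Finset.sum_sub_distrib, ← Finset.sum_mul, hθ, one_mul]
  rw [h1]
  exact (even_two.convexOn_pow (𝕜 := ℝ)).map_sum_le (fun j _ => h0 j) hθ (fun j _ => Set.mem_univ _)

theorem sum_sq_sub_eq {θ : Fin M → ℝ} (hθ : ∑ j, θ j = 1) (y a : ℝ) (u : Fin M → ℝ) :
    ∑ j, θ j * (y - u j) ^ 2 =
      (y - a) ^ 2 - 2 * (y - a) * (∑ j, θ j * u j - a) + ∑ j, θ j * (u j - a) ^ 2 := by
  have h : ∀ j, θ j * (y - u j) ^ 2 = θ j * ((y - a) ^ 2 + 2 * (y - a) * a)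
      - 2 * (y - a) * (θ j * u j) + θ j * (u j - a) ^ 2 := fun j => by ring
  simp_rw [h]
  rw [Finset.sum_add_distrib, Finset.sum_sub_distrib, ← Finset.sum_mul, ← Finset.mul_sum, hθ]
  ring

/-! ### First-order optimality on the simplex. -/

theorem sum_segment_mul (θ c : Fin M → ℝ) (p : Fin M) (t : ℝ) :
    ∑ j, ((1 - t) • θ + t • (Pi.single p 1 : Fin M → ℝ)) j * c j
      = (1 - t) * ∑ j, θ j * c j + t * c p := by
  simp only [Pi.add_apply, Pi.smul_apply, smul_eq_mul, add_mul, Finset.sum_add_distrib,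
    Finset.mul_sum, mul_assoc]
  congr 1
  simp [Pi.single_apply]

/-- Optimality of Q-aggregation weights against the vertex `p`, including the curvature of the
objective. -/
theorem IsQAggregation.sum_pairExcess_le {X : 𝒵 → 𝒳} {Y : 𝒢 → 𝒵 → ℝ} {f : Fin M → 𝒳 → ℝ}
    {w : Fin M → ℝ} {β : ℝ} {g : 𝒢} {z : Fin n → 𝒵} {θ : Fin M → ℝ}
    (h : IsQAggregation X Y f w (1 / 2) β g z θ) (p : Fin M) :
    1 / (n : ℝ) * ∑ i, ∑ j, ∑ k, θ j * θ k *
        pairExcess (Y g (z i)) (f p (X (z i))) (f j (X (z i))) (f k (X (z i)))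
      + β / n * ∑ j, θ j * Real.log (1 / w j) ≤ β / n * Real.log (1 / w p) := by
  obtain ⟨hθ, hmin⟩ := h
  set B := 1 / (n : ℝ) * ∑ i, ∑ j, ∑ k, θ j * θ k *
        pairExcess (Y g (z i)) (f p (X (z i))) (f j (X (z i))) (f k (X (z i)))
      + β / n * ∑ j, θ j * Real.log (1 / w j) - β / n * Real.log (1 / w p) with hB
  set A := 1 / (n : ℝ) * ∑ i, (∑ j, θ j * f j (X (z i)) - f p (X (z i))) ^ 2 with hA
  -- Moving by `t` towards the vertex changes the objective by `-t * B + t ^ 2 / 2 * A`. The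
  -- endpoint `t = 1` would give only `B ≤ A / 2`; letting `t → 0` removes `A`.
  have key : ∀ t : ℝ, 0 < t → t ≤ 1 → B ≤ t * A := by
    intro t ht ht1
    have hmem : (1 - t) • θ + t • (Pi.single p 1 : Fin M → ℝ) ∈ stdSimplex ℝ (Fin M) :=
      convex_stdSimplex ℝ (Fin M) hθ (single_mem_stdSimplex ℝ p) (by linarith) ht.le (by ring)
    have hle : qObjective X Y f w (1 / 2) β g z θ ≤
      qObjective X Y f w (1 / 2) β g z _ := hmin hmem
    have hid : qObjective X Y f w (1 / 2) β g z
          ((1 - t) • θ + t • (Pi.single p 1 : Fin M → ℝ)) =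
        qObjective X Y f w (1 / 2) β g z θ - t * B + t ^ 2 / 2 * A
          := by
      unfold qObjective
      rw [sum_segment_mul]
      have hl : ∀ i, modifiedLoss X Y f (1 / 2)
            ((1 - t) • θ + t • (Pi.single p 1 : Fin M → ℝ)) g (z i) =
          modifiedLoss X Y f (1 / 2) θ g (z i)
            - t * ∑ j, ∑ k, θ j * θ k *
              pairExcess (Y g (z i)) (f p (X (z i))) (f j (X (z i))) (f k (X (z i)))
            + t ^ 2 / 2 * (∑ j, θ j * f j (X (z i)) - f p (X (z i))) ^ 2 := by
        intro i
        rw [sum_pairExcess hθ.2]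
        simp only [modifiedLoss, ensemble, sqLoss]
        rw [sum_segment_mul, sum_segment_mul,
          sum_sq_sub_eq hθ.2 (Y g (z i)) (f p (X (z i))) (fun j => f j (X (z i)))]
        ring
      simp_rw [hl]
      rw [Finset.sum_add_distrib, Finset.sum_sub_distrib, ← Finset.mul_sum, ← Finset.mul_sum,
        hB, hA]
      ring
    rw [hid] at hle
    have : t * B ≤ t * (t * A) := by
      have hA0 : 0 ≤ A := mul_nonneg (by positivity) (Finset.sum_nonneg fun _ _ => sq_nonneg _)
      nlinarith [mul_nonneg (sq_nonneg t) hA0]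
    exact le_of_mul_le_mul_left this ht
  have hlim : Filter.Tendsto (fun t : ℝ => t * A) (nhdsWithin 0 (Set.Ioi 0)) (nhds 0) := by
    have : Filter.Tendsto (fun t : ℝ => t * A) (nhds 0) (nhds (0 * A)) :=
      (continuous_id.mul continuous_const).tendsto 0
    rw [zero_mul] at this
    exact this.mono_left nhdsWithin_le_nhds
  have hB0 : B ≤ 0 := by
    refine ge_of_tendsto hlim ?_
    filter_upwards [Ioc_mem_nhdsGT (zero_lt_one' ℝ)] with t ht using key t ht.1 ht.2
  linarith

/-! ### Population risk and the bias of the labels. -/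

/-- Pull-out of a bounded factor, so that `u` need only be integrable, as is the case for `Y g₀`. -/
theorem integral_mul_condExp_of_bound {α : Type*} {m m0 : MeasurableSpace α} {P : Measure α}
    [IsFiniteMeasure P] (hm : m ≤ m0) {D u : α → ℝ} (hD : StronglyMeasurable[m] D) {c : ℝ}
    (hb : ∀ᵐ z ∂P, |D z| ≤ c) (hu : Integrable u P) :
    ∫ z, D z * (P[u | m]) z ∂P = ∫ z, D z * u z ∂P := by
  rw [← integral_condExp hm (f := fun z => D z * u z)]
  exact integral_congr_ae
    (condExp_stronglyMeasurable_mul_of_bound₀ hm hD.aestronglyMeasurable hu c hb).symm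

theorem abs_sum_mul_le {θ : Fin M → ℝ} (h0 : ∀ j, 0 ≤ θ j) (hθ : ∑ j, θ j = 1) {u : Fin M → ℝ}
    {U : ℝ} (hu : ∀ j, |u j| ≤ U) : |∑ j, θ j * u j| ≤ U := by
  refine (Finset.abs_sum_le_sum_abs _ _).trans ?_
  calc ∑ j, |θ j * u j| ≤ ∑ j, θ j * U := Finset.sum_le_sum fun j _ => by
        rw [abs_mul, abs_of_nonneg (h0 j)]; exact mul_le_mul_of_nonneg_left (hu j) (h0 j)
    _ = U := by rw [← Finset.sum_mul, hθ, one_mul]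

section Population

variable [MeasurableSpace 𝒵] [m𝒳 : MeasurableSpace 𝒳] {P : Measure 𝒵} [IsProbabilityMeasure P]
  {X : 𝒵 → 𝒳} {Y : 𝒢 → 𝒵 → ℝ} {g₀ g : 𝒢} {τ₀ : 𝒳 → ℝ} {f : Fin M → 𝒳 → ℝ} {U : ℝ}

/-- Almost everywhere the bias is `E[Y g | X] - τ₀(X)`: a conditional expectation of a bounded label
minus a square-integrable target. `Y g₀` itself need not be in `L²`. -/
theorem memLp_bias (hYm : Measurable (Y g)) (hY : ∀ᵐ z ∂P, |Y g z| ≤ U)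
    (hY0 : Integrable (Y g₀) P)
    (hτ : (fun z => τ₀ (X z)) =ᵐ[P] P[Y g₀ | MeasurableSpace.comap X m𝒳])
    (hτ2 : MemLp (fun z => τ₀ (X z)) 2 P) : MemLp (bias P X Y g₀ g) 2 P := by
  have hYg : MemLp (Y g) 2 P := MemLp.of_bound hYm.aestronglyMeasurable U hY
  have h1 : MemLp (P[Y g | MeasurableSpace.comap X m𝒳] - fun z => τ₀ (X z)) 2 P :=
    (hYg.condExp one_le_two).sub hτ2
  refine (memLp_congr_ae ?_).1 h1
  filter_upwards [condExp_sub (hYg.integrable one_le_two) hY0 (MeasurableSpace.comap X m𝒳), hτ]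
    with z h2 h3
  have h4 : bias P X Y g₀ g z = (P[Y g - Y g₀ | MeasurableSpace.comap X m𝒳]) z := rfl
  rw [h4, h2, Pi.sub_apply, Pi.sub_apply, h3]

/-- The excess risk of a convex combination over a single model, in terms of the pairwise excess
losses at the nuisance `g` and of the bias of the labels at `g`. -/
theorem sqDist_ensemble_le (hX : Measurable X) (hYm : Measurable (Y g))
    (hY : ∀ᵐ z ∂P, |Y g z| ≤ U) (hY0 : Integrable (Y g₀) P)
    (hτ : (fun z => τ₀ (X z)) =ᵐ[P] P[Y g₀ | MeasurableSpace.comap X m𝒳])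
    (hτ2 : MemLp (fun z => τ₀ (X z)) 2 P) (hf : ∀ j, Measurable (f j))
    (hfU : ∀ j, ∀ᵐ z ∂P, |f j (X z)| ≤ U) {θ : Fin M → ℝ} (hθ : θ ∈ stdSimplex ℝ (Fin M))
    (p : Fin M) {c : ℝ} (hc : 0 < c) :
    sqDist P X (ensemble f θ) τ₀ ≤ sqDist P X (f p) τ₀
      + ∑ j, ∑ k, θ j * θ k * ∫ z, pairExcess (Y g z) (f p (X z)) (f j (X z)) (f k (X z)) ∂P
      - (1 / 2 - c) * ∑ j, θ j * ∫ z, (f j (X z) - f p (X z)) ^ 2 ∂P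
      + 1 / c * ∫ z, bias P X Y g₀ g z ^ 2 ∂P := by
  have hm : MeasurableSpace.comap X m𝒳 ≤ (inferInstance : MeasurableSpace 𝒵) := hX.comap_le
  have hF : Measurable (ensemble f θ) :=
    Finset.measurable_sum _ fun j _ => (hf j).const_mul (θ j)
  have hall : ∀ᵐ z ∂P, ∀ j, |f j (X z)| ≤ U := ae_all_iff.2 hfU
  have hFU : ∀ᵐ z ∂P, |ensemble f θ (X z)| ≤ U := by
    filter_upwards [hall] with z hz using abs_sum_mul_le hθ.1 hθ.2 hz
  have mY : MemLp (Y g) 2 P := MemLp.of_bound hYm.aestronglyMeasurable U hY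
  have mf : ∀ j, MemLp (fun z => f j (X z)) 2 P := fun j =>
    MemLp.of_bound ((hf j).comp hX).aestronglyMeasurable U (hfU j)
  have mF : MemLp (fun z => ensemble f θ (X z)) 2 P :=
    MemLp.of_bound (hF.comp hX).aestronglyMeasurable U hFU
  have mb := memLp_bias hYm hY hY0 hτ hτ2
  have mD : MemLp (fun z => ensemble f θ (X z) - f p (X z)) 2 P := mF.sub (mf p)
  have hDU : ∀ᵐ z ∂P, |ensemble f θ (X z) - f p (X z)| ≤ U + U := by
    filter_upwards [hFU, hfU p] with z h1 h2 using (abs_sub _ _).trans (add_le_add h1 h2)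
  have hDm : StronglyMeasurable[MeasurableSpace.comap X m𝒳]
      (fun z => ensemble f θ (X z) - f p (X z)) :=
    ((hF.sub (hf p)).comp (comap_measurable X)).stronglyMeasurable
  have iY : Integrable (Y g) P := mY.integrable one_le_two
  have iDτ : Integrable (fun z => (ensemble f θ (X z) - f p (X z)) * τ₀ (X z)) P :=
    mD.integrable_mul hτ2
  have iDY : Integrable (fun z => (ensemble f θ (X z) - f p (X z)) * Y g z) P :=
    mD.integrable_mul mY
  have iDb : Integrable (fun z => (ensemble f θ (X z) - f p (X z)) * bias P X Y g₀ g z) P :=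
    mD.integrable_mul mb
  have iDY0 : Integrable (fun z => (ensemble f θ (X z) - f p (X z)) * Y g₀ z) P :=
    hY0.bdd_mul mD.1 hDU
  have e1 : ∫ z, (ensemble f θ (X z) - f p (X z)) * τ₀ (X z) ∂P =
      ∫ z, (ensemble f θ (X z) - f p (X z)) * Y g z ∂P
        - ∫ z, (ensemble f θ (X z) - f p (X z)) * bias P X Y g₀ g z ∂P := by
    have e2 : ∫ z, (ensemble f θ (X z) - f p (X z)) * τ₀ (X z) ∂P =
        ∫ z, (ensemble f θ (X z) - f p (X z)) * Y g₀ z ∂P := by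
      rw [← integral_mul_condExp_of_bound hm hDm hDU hY0]
      refine integral_congr_ae ?_
      filter_upwards [hτ] with z hz
      rw [hz]
    have e3 : ∫ z, (ensemble f θ (X z) - f p (X z)) * bias P X Y g₀ g z ∂P =
        ∫ z, (ensemble f θ (X z) - f p (X z)) * (Y g z - Y g₀ z) ∂P :=
      integral_mul_condExp_of_bound hm hDm hDU (iY.sub hY0)
    rw [e2, e3, ← integral_sub iDY]
    · refine integral_congr_ae (Filter.Eventually.of_forall fun z => ?_)
      ring
    · simp_rw [mul_sub]; exact iDY.sub iDY0
  have iHτ : Integrable (fun z => (f p (X z) - τ₀ (X z)) ^ 2) P := ((mf p).sub hτ2).integrable_sq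
  have iFτ : Integrable (fun z => (ensemble f θ (X z) - τ₀ (X z)) ^ 2) P :=
    (mF.sub hτ2).integrable_sq
  have id : ∀ j, Integrable (fun z => (f j (X z) - f p (X z)) ^ 2) P := fun j =>
    ((mf j).sub (mf p)).integrable_sq
  have ib : Integrable (fun z => bias P X Y g₀ g z ^ 2) P := mb.integrable_sq
  have iPE : ∀ j k, Integrable
      (fun z => pairExcess (Y g z) (f p (X z)) (f j (X z)) (f k (X z))) P := by
    intro j k
    have a1 := (mY.sub (((mf j).add (mf k)).const_mul (1 / 2))).integrable_sq
    have a2 := (mY.sub (mf p)).integrable_sq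
    have a3 := (((mf j).sub (mf p)).integrable_mul ((mf k).sub (mf p))).const_mul (1 / 2)
    refine ((a1.sub a2).add a3).congr (Filter.Eventually.of_forall fun z => ?_)
    simp only [pairExcess, Pi.add_apply, Pi.sub_apply, Pi.mul_apply]
    ring
  have iS1 : Integrable (fun z => ∑ j, ∑ k, θ j * θ k *
      pairExcess (Y g z) (f p (X z)) (f j (X z)) (f k (X z))) P :=
    integrable_finsetSum _ fun j _ => integrable_finsetSum _ fun k _ => (iPE j k).const_mul _
  have iS2 : Integrable (fun z => ∑ j, θ j * (f j (X z) - f p (X z)) ^ 2) P :=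
    integrable_finsetSum _ fun j _ => (id j).const_mul _
  have eS1 : ∫ z, ∑ j, ∑ k, θ j * θ k *
      pairExcess (Y g z) (f p (X z)) (f j (X z)) (f k (X z)) ∂P =
      ∑ j, ∑ k, θ j * θ k *
        ∫ z, pairExcess (Y g z) (f p (X z)) (f j (X z)) (f k (X z)) ∂P := by
    rw [integral_finsetSum _ fun j _ =>
      integrable_finsetSum _ fun k _ => (iPE j k).const_mul _]
    refine Finset.sum_congr rfl fun j _ => ?_
    rw [integral_finsetSum _ fun k _ => (iPE j k).const_mul _]
    exact Finset.sum_congr rfl fun k _ => integral_const_mul _ _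
  have eS2 : ∫ z, ∑ j, θ j * (f j (X z) - f p (X z)) ^ 2 ∂P =
      ∑ j, θ j * ∫ z, (f j (X z) - f p (X z)) ^ 2 ∂P := by
    rw [integral_finsetSum _ fun j _ => (id j).const_mul _]
    exact Finset.sum_congr rfl fun j _ => integral_const_mul _ _
  -- The last three terms integrate to zero by `e1`. The bias cross term is split by Young's
  -- inequality with parameter `c`, then Jensen replaces `(f_θ - f_p)²` by the `θ`-average of `(f_j
  -- - f_p)²`.
  have hpt : ∀ z, (ensemble f θ (X z) - τ₀ (X z)) ^ 2 ≤ (f p (X z) - τ₀ (X z)) ^ 2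
      + ∑ j, ∑ k, θ j * θ k * pairExcess (Y g z) (f p (X z)) (f j (X z)) (f k (X z))
      - (1 / 2 - c) * ∑ j, θ j * (f j (X z) - f p (X z)) ^ 2
      + 1 / c * bias P X Y g₀ g z ^ 2
      + 2 * ((ensemble f θ (X z) - f p (X z)) * Y g z)
      - 2 * ((ensemble f θ (X z) - f p (X z)) * bias P X Y g₀ g z)
      - 2 * ((ensemble f θ (X z) - f p (X z)) * τ₀ (X z)) := by
    intro z
    have h1 := sum_pairExcess hθ.2 (Y g z) (f p (X z)) fun j => f j (X z)
    have h2 := sq_sum_sub_le hθ.1 hθ.2 (f p (X z)) fun j => f j (X z)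
    rw [h1]
    change (∑ j, θ j * f j (X z) - τ₀ (X z)) ^ 2 ≤ _
    simp only [ensemble]
    have h3 := mul_le_mul_of_nonneg_left h2 hc.le
    have h4 : 2 * ((∑ j, θ j * f j (X z) - f p (X z)) * bias P X Y g₀ g z) ≤
        c * (∑ j, θ j * f j (X z) - f p (X z)) ^ 2 + 1 / c * bias P X Y g₀ g z ^ 2 := by
      have h5 : 0 ≤ 1 / c * (c * (∑ j, θ j * f j (X z) - f p (X z)) - bias P X Y g₀ g z) ^ 2 := by
        positivity
      have h6 : 1 / c * (c * (∑ j, θ j * f j (X z) - f p (X z)) - bias P X Y g₀ g z) ^ 2 =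
          c * (∑ j, θ j * f j (X z) - f p (X z)) ^ 2 + 1 / c * bias P X Y g₀ g z ^ 2
          - 2 * ((∑ j, θ j * f j (X z) - f p (X z)) * bias P X Y g₀ g z) := by
        field_simp
        ring
      linarith
    linarith
  have i1 := iHτ.add iS1
  have i2 := i1.sub (iS2.const_mul (1 / 2 - c))
  have i3 := i2.add (ib.const_mul (1 / c))
  have i4 := i3.add (iDY.const_mul 2)
  have i5 := i4.sub (iDb.const_mul 2)
  have i6 := i5.sub (iDτ.const_mul 2)
  have hfin := integral_mono iFτ i6 hpt
  rw [integral_sub' i5 (iDτ.const_mul 2), integral_sub' i4 (iDb.const_mul 2),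
    integral_add' i3 (iDY.const_mul 2), integral_add' i2 (ib.const_mul (1 / c)),
    integral_sub' i1 (iS2.const_mul (1 / 2 - c)), integral_add' iHτ iS1,
    integral_const_mul, integral_const_mul, integral_const_mul, integral_const_mul,
    integral_const_mul, eS1, eS2, e1] at hfin
  unfold sqDist
  linarith

theorem integral_sq_pairExcess_le (hX : Measurable X)
    (hY : ∀ᵐ z ∂P, |Y g z| ≤ U) (hf : ∀ j, Measurable (f j))
    (hfU : ∀ j, ∀ᵐ z ∂P, |f j (X z)| ≤ U) (p j k : Fin M) :
    ∫ z, pairExcess (Y g z) (f p (X z)) (f j (X z)) (f k (X z)) ^ 2 ∂P ≤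
      25 / 2 * U ^ 2 * (∫ z, (f j (X z) - f p (X z)) ^ 2 ∂P
        + ∫ z, (f k (X z) - f p (X z)) ^ 2 ∂P) := by
  have mf : ∀ j, MemLp (fun z => f j (X z)) 2 P := fun j =>
    MemLp.of_bound ((hf j).comp hX).aestronglyMeasurable U (hfU j)
  have id : ∀ j, Integrable (fun z => (f j (X z) - f p (X z)) ^ 2) P := fun j =>
    ((mf j).sub (mf p)).integrable_sq
  rw [← integral_add (id j) (id k), ← integral_const_mul]
  refine integral_mono_of_nonneg (Filter.Eventually.of_forall fun z => sq_nonneg _)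
    (((id j).add (id k)).const_mul _) ?_
  filter_upwards [hY, hfU p, hfU j, hfU k] with z h1 h2 h3 h4 using sq_pairExcess_le h1 h2 h3 h4

end Population

/-! ### Deterministic oracle inequality on the deviation event. -/

/-- The oracle inequality on the event that the empirical means of all pairwise excess losses
satisfy the deviation bound. -/
theorem sqDist_ensemble_le_of_deviation [MeasurableSpace 𝒵] [m𝒳 : MeasurableSpace 𝒳]
    {P : Measure 𝒵} [IsProbabilityMeasure P]
    {X : 𝒵 → 𝒳} {Y : 𝒢 → 𝒵 → ℝ} {g₀ g : 𝒢} {τ₀ : 𝒳 → ℝ} {f : Fin M → 𝒳 → ℝ} {U : ℝ}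
    (hX : Measurable X) (hYm : Measurable (Y g))
    (hY : ∀ᵐ z ∂P, |Y g z| ≤ U) (hY0 : Integrable (Y g₀) P)
    (hτ : (fun z => τ₀ (X z)) =ᵐ[P] P[Y g₀ | MeasurableSpace.comap X m𝒳])
    (hτ2 : MemLp (fun z => τ₀ (X z)) 2 P) (hf : ∀ j, Measurable (f j))
    (hfU : ∀ j, ∀ᵐ z ∂P, |f j (X z)| ≤ U) (hn : 0 < n) {z : Fin n → 𝒵} {w : Fin M → ℝ} {β : ℝ}
    {θ : Fin M → ℝ} (hθ : IsQAggregation X Y f w (1 / 2) β g z θ) (p : Fin M)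
    (hU : 0 < U) (hβ : 112 * U ^ 2 ≤ β) (hw : ∀ j, 0 < w j)
    (hlw : ∀ j, 0 ≤ Real.log (1 / w j)) {L : ℝ} (hL : 0 ≤ L)
    (hdev : ∀ a : Fin M × Fin M, ∑ i, -(1 / (56 * U ^ 2)) *
        pairExcess (Y g (z i)) (f p (X (z i))) (f a.1 (X (z i))) (f a.2 (X (z i))) ≤
      n * (∫ x, -(1 / (56 * U ^ 2)) *
          pairExcess (Y g x) (f p (X x)) (f a.1 (X x)) (f a.2 (X x)) ∂P
        + ∫ x, (-(1 / (56 * U ^ 2)) *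
          pairExcess (Y g x) (f p (X x)) (f a.1 (X x)) (f a.2 (X x))) ^ 2 ∂P)
      + (L + Real.log (1 / (w a.1 * w a.2)))) :
    sqDist P X (ensemble f θ) τ₀ ≤ sqDist P X (f p) τ₀ + β / n * Real.log (1 / w p)
      + 56 * (max (U ^ 2) (U ^ 3) * L / n + nuisanceError P X Y g₀ g ^ 2) := by
  -- With `c = 3/56`, the surplus `1/2 - c = 25/56` exactly cancels the second-moment cost in
  -- `hsum`.
  have hpop := sqDist_ensemble_le hX hYm hY hY0 hτ hτ2 hf hfU hθ.1 p
    (c := 3 / 56) (by norm_num)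
  have hopt := hθ.sum_pairExcess_le p
  set A : Fin M → Fin M → ℝ := fun j k =>
    ∫ x, pairExcess (Y g x) (f p (X x)) (f j (X x)) (f k (X x)) ∂P with hA
  set W : Fin M → ℝ := fun j => ∫ x, (f j (X x) - f p (X x)) ^ 2 ∂P with hW
  set E : Fin M → Fin M → ℝ := fun j k =>
    ∑ i, pairExcess (Y g (z i)) (f p (X (z i))) (f j (X (z i))) (f k (X (z i))) with hE
  have hn' : (0 : ℝ) < n := by exact_mod_cast hn
  have hpair : ∀ j k, A j k ≤ 1 / n * E j k + 25 / 112 * (W j + W k)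
      + (56 * U ^ 2 / n * L
        + 56 * U ^ 2 / n * (Real.log (1 / w j) + Real.log (1 / w k))) := by
    intro j k
    have h := hdev (j, k)
    have hB := integral_sq_pairExcess_le hX hY hf hfU p j k
    simp only [mul_pow, integral_const_mul] at h
    rw [← Finset.mul_sum, ← one_div_mul_one_div (w j),
      Real.log_mul (one_div_ne_zero (hw j).ne') (one_div_ne_zero (hw k).ne')] at h
    change -(1 / (56 * U ^ 2)) * E j k ≤ n * (-(1 / (56 * U ^ 2)) * A j k + _) + _ at h
    change _ ≤ 25 / 2 * U ^ 2 * (W j + W k) at hB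
    have h1 := mul_le_mul_of_nonneg_left h (by positivity : 0 ≤ 56 * U ^ 2 / n)
    have h2 := mul_le_mul_of_nonneg_left hB (by positivity : 0 ≤ 1 / (56 * U ^ 2))
    have e1 : 56 * U ^ 2 / n * (-(1 / (56 * U ^ 2)) * E j k) = -(1 / n * E j k) := by
      field_simp
    have e2 : 1 / (56 * U ^ 2) * (25 / 2 * U ^ 2 * (W j + W k)) = 25 / 112 * (W j + W k) := by
      field_simp
      ring
    rw [e1] at h1
    rw [e2] at h2
    refine le_of_sub_nonneg ?_
    have e3 : ∀ I : ℝ, 56 * U ^ 2 / n * (n * (-(1 / (56 * U ^ 2)) * A j k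
        + (-(1 / (56 * U ^ 2))) ^ 2 * I) + (L + (Real.log (1 / w j) + Real.log (1 / w k)))) =
        -A j k + 1 / (56 * U ^ 2) * I + (56 * U ^ 2 / n * L
        + 56 * U ^ 2 / n * (Real.log (1 / w j) + Real.log (1 / w k))) := by
      intro I
      field_simp
    rw [e3] at h1
    linarith
  have hsum : ∑ j, ∑ k, θ j * θ k * A j k ≤ 1 / n * ∑ j, ∑ k, θ j * θ k * E j k
      + 25 / 56 * ∑ j, θ j * W j + 56 * U ^ 2 / n * L
      + 112 * U ^ 2 / n * ∑ j, θ j * Real.log (1 / w j) := by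
    have h1 : ∑ j, ∑ k, θ j * θ k * A j k ≤ ∑ j, ∑ k, θ j * θ k * (1 / n * E j k
        + 25 / 112 * (W j + W k) + (56 * U ^ 2 / n * L
        + 56 * U ^ 2 / n * (Real.log (1 / w j) + Real.log (1 / w k)))) :=
      Finset.sum_le_sum fun j _ => Finset.sum_le_sum fun k _ =>
        mul_le_mul_of_nonneg_left (hpair j k) (mul_nonneg (hθ.1.1 j) (hθ.1.1 k))
    refine h1.trans (le_of_eq ?_)
    have h2 : ∀ j k, θ j * θ k * (1 / n * E j k
        + 25 / 112 * (W j + W k) + (56 * U ^ 2 / n * L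
        + 56 * U ^ 2 / n * (Real.log (1 / w j) + Real.log (1 / w k)))) =
        1 / n * (θ j * θ k * E j k) + 25 / 112 * (θ j * θ k * (W j + W k))
        + (θ j * θ k * (56 * U ^ 2 / n * L) + 56 * U ^ 2 / n *
          (θ j * θ k * (Real.log (1 / w j) + Real.log (1 / w k)))) := fun j k => by ring
    simp_rw [h2, Finset.sum_add_distrib]
    rw [sum_sum_mul_const hθ.1.2]
    simp_rw [← Finset.mul_sum]
    rw [sum_sum_mul_symm hθ.1.2, sum_sum_mul_symm hθ.1.2 fun j => Real.log (1 / w j)]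
    ring
  have hswap : ∑ i, ∑ j, ∑ k, θ j * θ k *
      pairExcess (Y g (z i)) (f p (X (z i))) (f j (X (z i))) (f k (X (z i))) =
      ∑ j, ∑ k, θ j * θ k * E j k := by
    rw [Finset.sum_comm]
    refine Finset.sum_congr rfl fun j _ => ?_
    rw [Finset.sum_comm]
    exact Finset.sum_congr rfl fun k _ => (Finset.mul_sum _ _ _).symm
  rw [hswap] at hopt
  -- The factor is `2 * 56`, one `56` for each index of the pair; the penalty in `hopt` absorbs it.
  have hK : 112 * U ^ 2 / n * ∑ j, θ j * Real.log (1 / w j) ≤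
      β / n * ∑ j, θ j * Real.log (1 / w j) :=
    mul_le_mul_of_nonneg_right (by gcongr)
      (Finset.sum_nonneg fun j _ => mul_nonneg (hθ.1.1 j) (hlw j))
  have herr : nuisanceError P X Y g₀ g ^ 2 = 4 * ∫ x, bias P X Y g₀ g x ^ 2 ∂P := by
    unfold nuisanceError
    rw [mul_pow, Real.sq_sqrt (integral_nonneg fun x => sq_nonneg _)]
    norm_num
  have hb0 : 0 ≤ ∫ x, bias P X Y g₀ g x ^ 2 ∂P := integral_nonneg fun x => sq_nonneg _
  have hmax : 56 * U ^ 2 / n * L ≤ 56 * (max (U ^ 2) (U ^ 3) * L / n) := by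
    have : U ^ 2 * L / n ≤ max (U ^ 2) (U ^ 3) * L / n := by
      gcongr
      exact le_max_left _ _
    calc 56 * U ^ 2 / n * L = 56 * (U ^ 2 * L / n) := by ring
      _ ≤ _ := by linarith
  rw [herr]
  norm_num at hpop
  linarith

end QAgg

/-! ### The high-probability statement. -/

theorem corollary1 :
    ∃ C : ℝ, 0 < C ∧
      ∀ (Ω : Type*) (𝒵 : Type*) (𝒳 : Type*) (𝒢 : Type*)
        [MeasurableSpace Ω] [MeasurableSpace 𝒵] [m𝒳 : MeasurableSpace 𝒳] [MeasurableSpace 𝒢]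
        -- the probability space, and the law of one observation
        (μ : Measure Ω) [IsProbabilityMeasure μ] (P : Measure 𝒵) [IsProbabilityMeasure P]
        -- covariates, labels, true nuisance, target, candidate models
        (X : 𝒵 → 𝒳) (_ : Measurable X)
        (Y : 𝒢 → 𝒵 → ℝ) (_ : Measurable (Function.uncurry Y)) (g₀ : 𝒢)
        (_ : Integrable (Y g₀) P)
        (τ₀ : 𝒳 → ℝ) (_ : (fun z => τ₀ (X z)) =ᵐ[P] P[Y g₀ | MeasurableSpace.comap X m𝒳])
        (_ : MemLp (fun z => τ₀ (X z)) 2 P)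
        (M : ℕ) (f : Fin M → 𝒳 → ℝ) (_ : ∀ j, Measurable (f j))
        -- an i.i.d. sample, and a nuisance estimate that is independent of it
        (n : ℕ) (_ : 0 < n) (Z : Fin n → Ω → 𝒵) (_ : ∀ i, Measurable (Z i))
        (_ : iIndepFun Z μ) (_ : ∀ i, Measure.map (Z i) μ = P)
        (ghat : Ω → 𝒢) (_ : Measurable ghat)
        (_ : IndepFun ghat (fun ω i => Z i ω) μ)
        -- boundedness
        (U : ℝ) (_ : ∀ᵐ ω ∂μ, ∀ᵐ z ∂P, |Y (ghat ω) z| ≤ U)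
        (_ : ∀ j, ∀ᵐ z ∂P, |f j (X z)| ≤ U)
        -- prior weights, regularization, and the ensemble with `ν = 1 / 2`
        (w : Fin M → ℝ) (_ : ∀ j, 0 < w j) (_ : ∑ j, w j = 1)
        (β : ℝ) (_ : max (112 * U ^ 2) (56 * U ^ 3) ≤ β)
        (θhat : Ω → Fin M → ℝ)
        (_ : ∀ ω, QAgg.IsQAggregation X Y f w (1 / 2) β (ghat ω) (fun i => Z i ω) (θhat ω))
        (δ : ℝ) (_ : 0 < δ) (_ : δ < 1),
        -- the oracle inequality fails with probability at most `δ`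
        μ {ω | ¬ (QAgg.sqDist P X (QAgg.ensemble f (θhat ω)) τ₀ ≤
            (⨅ j, (QAgg.sqDist P X (f j) τ₀ + β / (n : ℝ) * Real.log (1 / w j)))
              + C * (max (U ^ 2) (U ^ 3) * Real.log (1 / δ) / (n : ℝ)
                  + QAgg.nuisanceError P X Y g₀ (ghat ω) ^ 2))}
          ≤ ENNReal.ofReal δ := by 
  refine ⟨56, by norm_num, ?_⟩
  intro Ω 𝒵 𝒳 𝒢 _ _ m𝒳 _ μ _ P _ X hX Y hY g₀ hY0 τ₀ hτ hτ2 M f hf n hn Z hZ hind hlaw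
    ghat hg hgZ U hYU hfU w hw hw1 β hβ θhat hθ δ hδ hδ1
  have hYm : ∀ g, Measurable (Y g) := fun g => hY.comp measurable_prodMk_left
  have hM : Nonempty (Fin M) := by
    by_contra h
    rw [not_nonempty_iff] at h
    simp at hw1
  -- The oracle index is deterministic, so the union bound runs over pairs only.
  obtain ⟨p, hp⟩ := exists_eq_ciInf_of_finite (f := fun j =>
    QAgg.sqDist P X (f j) τ₀ + β / (n : ℝ) * Real.log (1 / w j))
  have hU0 : 0 ≤ U := by
    obtain ⟨z, hz⟩ := (hfU p).exists
    exact (abs_nonneg _).trans hz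
  have hL : 0 < Real.log (1 / δ) := Real.log_pos (by rw [one_div]; exact (one_lt_inv₀ hδ).2 hδ1)
  have hw_le : ∀ j, w j ≤ 1 := fun j => by
    rw [← hw1]; exact Finset.single_le_sum (fun i _ => (hw i).le) (Finset.mem_univ j)
  have hlw : ∀ j, 0 ≤ Real.log (1 / w j) := fun j =>
    Real.log_nonneg (by rw [one_div]; exact (one_le_inv₀ (hw j)).2 (hw_le j))
  have hβU : 112 * U ^ 2 ≤ β := (le_max_left _ _).trans hβ
  -- The scale `1 / (56 * U ^ 2)` needs `U > 0`. For `U = 0` all candidates vanish almost surely,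
  -- and every ensemble has the risk of `f p`.
  rcases hU0.eq_or_lt with rfl | hU
  · have hβ0 : 0 ≤ β := by simpa using hβU
    have hempty : ∀ ω, QAgg.sqDist P X (QAgg.ensemble f (θhat ω)) τ₀ = QAgg.sqDist P X (f p) τ₀ := by
      intro ω
      refine integral_congr_ae ?_
      filter_upwards [ae_all_iff.2 hfU] with z hz
      have hz' : ∀ j, f j (X z) = 0 := fun j => abs_nonpos_iff.1 (hz j)
      simp [QAgg.ensemble, hz']
    refine (measure_mono (t := ∅) fun ω hω => (hω ?_).elim).trans (by simp)
    rw [← hp, hempty ω]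
    have h1 : 0 ≤ β / (n : ℝ) * Real.log (1 / w p) := mul_nonneg (by positivity) (hlw p)
    have h2 : 0 ≤ QAgg.nuisanceError P X Y g₀ (ghat ω) ^ 2 := sq_nonneg _
    simp only [ne_eq, OfNat.ofNat_ne_zero, not_false_eq_true, zero_pow, max_self, zero_mul,
      zero_div, zero_add]
    linarith
  let q : Fin M × Fin M → ℝ := fun a => w a.1 * w a.2
  have hq1 : ∑ a, q a = 1 := by
    rw [Fintype.sum_prod_type]
    simp only [q]
    rw [← Finset.sum_mul_sum, hw1, one_mul]
  -- Since `|pairExcess| ≤ 10 * U ^ 2`, this gives `|v| ≤ 1`. The second-moment cost `25 * l * U ^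
  -- 2` stays below `1/2`, and the log-prior cost `2 / l` equals `112 * U ^ 2`.
  let l : ℝ := 1 / (56 * U ^ 2)
  have hl : 0 < l := by positivity
  have hlU : l * (56 * U ^ 2) = 1 := one_div_mul_cancel (by positivity)
  let v : Fin M × Fin M → 𝒢 → 𝒵 → ℝ := fun a g z =>
    -l * QAgg.pairExcess (Y g z) (f p (X z)) (f a.1 (X z)) (f a.2 (X z))
  have hv : ∀ a, Measurable (Function.uncurry (v a)) := by
    intro a
    have hfm : ∀ j, Measurable fun x : 𝒢 × 𝒵 => f j (X x.2) := fun j =>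
      (hf j).comp (hX.comp measurable_snd)
    have hY' : Measurable fun x : 𝒢 × 𝒵 => Y x.1 x.2 := hY
    refine Measurable.const_mul ?_ (-l)
    unfold QAgg.pairExcess
    exact (((hY'.sub (((hfm a.1).add (hfm a.2)).div_const 2)).pow_const 2).sub
      ((hY'.sub (hfm p)).pow_const 2)).add
      ((((hfm a.1).sub (hfm p)).mul ((hfm a.2).sub (hfm p))).div_const 2)
  have hb : ∀ᵐ ω ∂μ, ∀ a, ∀ᵐ z ∂P, |v a (ghat ω) z| ≤ 1 := by
    filter_upwards [hYU] with ω hω a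
    filter_upwards [hω, ae_all_iff.2 hfU] with z h1 h2
    have h3 := QAgg.abs_pairExcess_le_const h1 (h2 p) (h2 a.1) (h2 a.2)
    simp only [v]
    rw [abs_mul, abs_neg, abs_of_pos hl]
    have h4 := mul_le_mul_of_nonneg_left h3 hl.le
    linarith
  -- The failure event lies, up to a null set, in the deviation event, which does not involve
  -- `θhat`; hence no measurable choice of minimizer is needed.
  refine (measure_mono_ae ?_).trans
    (measure_exists_sum_gt_le hZ hind hlaw hg hgZ hv hb (q := q)
      (fun a => mul_pos (hw _) (hw _)) hq1 hδ)
  filter_upwards [hYU] with ω hω hbad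
  by_contra hgood
  refine hbad ?_
  replace hgood : ¬ ∃ a, n * (∫ z, v a (ghat ω) z ∂P + ∫ z, v a (ghat ω) z ^ 2 ∂P)
      + (Real.log (1 / δ) + Real.log (1 / q a)) < ∑ i, v a (ghat ω) (Z i ω) := hgood
  push Not at hgood
  rw [← hp]
  exact QAgg.sqDist_ensemble_le_of_deviation hX (hYm _) hω hY0 hτ hτ2 hf hfU hn (hθ ω) p hU hβU
    hw hlw hL.le hgood
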